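/- Let $\Gamma$ be a countable (discrete) amenable group acting by homeomorphisms on a compact metrizable space $X$, and let $d$ be a metric inducing the topology of $X$. Suppose that the action (i) is expansive: there is $c>0$ such that for all $x\neq y$ in $X$ there is $g\in\Gamma$ with $d(gx,gy)>c$; (ii) has the pseudo-orbit tracing property: for every $\varepsilon>0$ there are $\delta>0$ and a finite set $S\subset\Gamma$ such that for every family $(x_g)_{g\in\Gamma}$ in $X$ with $d(s x_g,x_{sg})<\delta$ for all $s\in S$, $g\in\Gamma$ there is $y\in X$ with $d(gy,x_g)<\varepsilon$ for all $g\in\Gamma$; (iii) has positive topological entropy $$h(\Gamma\curvearrowright X)=\sup_{\delta>0}\ \limsup_{F}\ \frac{1}{|F|}\log \mathrm{sep}_{\delta,F}(X,d)>0 .$$ Here $\mathrm{sep}_{\delta,F}(X,d)$ is the maximal cardinality of a set $Y\subset X$ such that $\max_{g\in F}d(gx,gy)\ge\delta$ for all distinct $x,y\in Y$, and the upper limit is taken as the nonempty finite set $F\subset\Gamma$ becomes more and more left invariant, that is, it is the infimum over finite $K\subset\Gamma$ and $\eta>0$ of the supremum over all nonempty finite $F$ with $|gF\,\triangle\, F|\le\eta|F|$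 for all $g\in K$. Then the action has an off-diagonal asymptotic pair: there are $x\neq y$ in $X$ such that $d(gx,gy)\to 0$ as $g\to\infty$ in $\Gamma$, i.e. for every $\varepsilon>0$ there are at most finitely many $g\in\Gamma$ with $d(gx,gy)>\varepsilon$. -/

import Mathlib

open Filter Topology
open scoped Pointwise symmDiff ENNReal

namespace GroupDynamics

/-- The nonempty finite subsets `F` of `Γ` with `|gF ∆ F| ≤ ε |F|` for all `g ∈ K`. -/
def leftInvariantSets (Γ : Type*) [Group Γ] (K : Finset Γ) (ε : ℝ) : Set (Finset Γ) :=
  {F | F.Nonempty ∧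
    ∀ g ∈ K, (((g • (F : Set Γ)) ∆ (F : Set Γ)).ncard : ℝ) ≤ ε * (F.card : ℝ)}

/-- Amenability of a (discrete) group, as the left Følner condition. -/
def IsAmenable (Γ : Type*) [Group Γ] : Prop :=
  ∀ (K : Finset Γ) (ε : ℝ), 0 < ε → (leftInvariantSets Γ K ε).Nonempty

/-- The filter on finite subsets of `Γ` that expresses "as `F` becomes more and more left
invariant". A sequence of nonempty finite sets tends to this filter if and only if it is a left
Følner sequence. -/
def folnerFilter (Γ : Type*) [Group Γ] : Filter (Finset Γ) :=
  ⨅ (K : Finset Γ) (ε : ℝ) (_ : 0 < ε), 𝓟 (leftInvariantSets Γ K ε)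

section Action

variable (Γ : Type*) (X : Type*) [Group Γ] [MetricSpace X] [MulAction Γ X]

/-- The action is expansive: distinct points are at some time further apart than a constant. -/
def IsExpansive : Prop :=
  ∃ c : ℝ, 0 < c ∧ ∀ x y : X, x ≠ y → ∃ g : Γ, c < dist (g • x) (g • y)

variable {Γ X}

/-- `(S, δ)` pseudo-orbits. -/
def IsPseudoOrbit (S : Set Γ) (δ : ℝ) (x : Γ → X) : Prop :=
  ∀ s ∈ S, ∀ g : Γ, dist (s • x g) (x (s * g)) < δ

/-- The `Γ`-sequence `x` is `ε`-traced by the point `y`. -/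
def IsTracedBy (ε : ℝ) (x : Γ → X) (y : X) : Prop :=
  ∀ g : Γ, dist (g • y) (x g) < ε

/-- `(F, δ)`-separated sets. -/
def IsSeparatedSet (F : Finset Γ) (δ : ℝ) (Y : Set X) : Prop :=
  ∀ x ∈ Y, ∀ y ∈ Y, x ≠ y → ∃ g ∈ F, δ ≤ dist (g • x) (g • y)

/-- `(x, y)` is an asymptotic pair: `d(gx, gy) → 0` as `g` leaves every finite subset of `Γ`. -/
def IsAsymptoticPair (Γ : Type*) {X : Type*} [Group Γ] [MetricSpace X] [MulAction Γ X]
    (x y : X) : Prop :=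
  Tendsto (fun g : Γ => dist (g • x) (g • y)) cofinite (𝓝 0)

variable (X)

/-- The largest cardinality of an `(F, δ)`-separated subset of `X`. -/
noncomputable def sepNumber (F : Finset Γ) (δ : ℝ) : ℕ∞ :=
  ⨆ (Y : Set X) (_ : IsSeparatedSet F δ Y), Y.encard

variable (Γ)

/-- The pseudo-orbit tracing property. -/
def HasPseudoOrbitTracing : Prop :=
  ∀ ε : ℝ, 0 < ε → ∃ δ : ℝ, 0 < δ ∧ ∃ S : Finset Γ,
    ∀ x : Γ → X, IsPseudoOrbit (S : Set Γ) δ x → ∃ y : X, IsTracedBy ε x y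

/-- The topological entropy of an action of an amenable group on a compact metric space: the
supremum over `δ > 0` of the exponential growth rates of the maximal cardinalities of
`(F, δ)`-separated sets as `F` becomes more and more left invariant. -/
noncomputable def topEntropy : EReal :=
  ⨆ (δ : ℝ) (_ : 0 < δ),
    limsup (fun F : Finset Γ => ENNReal.log ((sepNumber X F δ : ℕ∞) : ℝ≥0∞) / (F.card : EReal))
      (folnerFilter Γ)

end Action

end GroupDynamics

/-!
The asymptotic pair is obtained by splicing two orbits along a finite set whose boundary is small.

Positive entropy gives a scale `δ₀` and a rate `a > 0` such that arbitrarily invariant finite sets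
`F` carry more than `exp (a |F|)` points that are pairwise `δ₀`-apart at some time in `F`
(`exists_separation_rate`). Take `ε` below `δ₀` and the expansivity constant, and let `S`, `δ` be
the data of pseudo-orbit tracing for `ε`. Cover `X` by `N` balls of radius `δ / 2`. The boundary
`B = ⋃ s ∈ S, sF ∆ F` has at most `η |S| |F|` elements when `F` is `(S, η)`-invariant, so for small
`η` there are at most `N ^ |B| ≤ exp (a |F|)` itineraries through the cover along `B`. By pigeonhole
(`exists_separated_close`) two points `x`, `y` are `δ₀`-apart somewhere in `F`, yet `δ`-close
along `B`.

The sequence that follows `x` on `F` and `y` off `F` is then a pseudo-orbit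
(`isPseudoOrbit_piecewise`), traced by some `z`. On `F` the point `z` stays `ε`-close to `x`, so
`z ≠ y`; off `F` it stays within the expansivity constant of `y`, and expansivity on a compact space
turns this into asymptoticity (`isAsymptoticPair_of_dist_le_off_finite`).
-/

namespace GroupDynamics

variable {Γ X : Type*} [Group Γ] [MetricSpace X] [MulAction Γ X]

/-- Uniform expansivity: two points of a compact space whose orbits stay within the expansivity
constant over a suitable finite set of times are close to each other. -/
theorem exists_finset_dist_lt [CompactSpace X] [ContinuousConstSMul Γ X] {c : ℝ}
    (hc : ∀ x y : X, x ≠ y → ∃ g : Γ, c < dist (g • x) (g • y)) {r : ℝ} (hr : 0 < r) :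
    ∃ K : Finset Γ, ∀ x y : X, (∀ g ∈ K, dist (g • x) (g • y) ≤ c) → dist x y < r := by
  have hcpt : IsCompact {p : X × X | r ≤ dist p.1 p.2} :=
    (isClosed_le continuous_const continuous_dist).isCompact
  obtain ⟨K, hK⟩ := hcpt.elim_finite_subcover
    (fun g : Γ => {p : X × X | c < dist (g • p.1) (g • p.2)})
    (fun g => isOpen_lt continuous_const
      ((continuous_fst.const_smul g).dist (continuous_snd.const_smul g)))
    (fun p hp => by
      have hne : p.1 ≠ p.2 := dist_pos.1 (hr.trans_le hp)
      exact Set.mem_iUnion.2 (hc _ _ hne))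
  refine ⟨K, fun x y h => ?_⟩
  by_contra! hxy
  have := hK (show (x, y) ∈ {p : X × X | r ≤ dist p.1 p.2} from hxy)
  simp only [Set.mem_iUnion] at this
  obtain ⟨g, hg, hlt⟩ := this
  exact (h g hg).not_gt hlt

theorem isAsymptoticPair_of_dist_le_off_finite [CompactSpace X] [ContinuousConstSMul Γ X] {c : ℝ}
    (hc : ∀ x y : X, x ≠ y → ∃ g : Γ, c < dist (g • x) (g • y)) {F : Set Γ} (hF : F.Finite)
    {x y : X} (h : ∀ g ∉ F, dist (g • x) (g • y) ≤ c) : IsAsymptoticPair Γ x y := by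
  rw [IsAsymptoticPair, Metric.tendsto_nhds]
  intro r hr
  obtain ⟨K, hK⟩ := exists_finset_dist_lt hc hr
  -- The times `g` with `Kg` disjoint from `F` are all but finitely many.
  refine Filter.mem_of_superset ((K.finite_toSet.inv.mul hF).compl_mem_cofinite) fun g hg => ?_
  simp only [Set.mem_ofPred_eq, Real.dist_0_eq_abs, abs_of_nonneg dist_nonneg]
  refine hK _ _ fun k hk => ?_
  rw [← mul_smul, ← mul_smul]
  refine h _ fun hkg => hg ?_
  exact Set.mem_mul.2 ⟨k⁻¹, Set.inv_mem_inv.2 hk, k * g, hkg, by group⟩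

/-- Splicing the orbits of `x` and `y` along `F` gives a pseudo-orbit, provided that they are close
along the `S`-boundary of `F`: the steps `g ↦ sg` that switch between the two orbits are exactly
those ending in `sF ∆ F`. -/
theorem isPseudoOrbit_piecewise {S F : Set Γ} [DecidablePred (· ∈ F)] {δ : ℝ} (hδ : 0 < δ)
    {x y : X} (h : ∀ s ∈ S, ∀ g ∈ (s • F) ∆ F, dist (g • x) (g • y) < δ) :
    IsPseudoOrbit S δ (F.piecewise (fun g => g • x) fun g => g • y) := by
  intro s hs g
  have hmem : s * g ∈ s • F ↔ g ∈ F := Set.smul_mem_smul_set_iff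
  by_cases hg : g ∈ F <;> by_cases hsg : s * g ∈ F
  · simpa [hg, hsg, mul_smul] using hδ
  · simpa [hg, hsg, mul_smul] using h s hs (s * g) (Or.inl ⟨hmem.2 hg, hsg⟩)
  · rw [dist_comm]
    simpa [hg, hsg, mul_smul] using h s hs (s * g) (Or.inr ⟨hsg, fun h' => hg (hmem.1 h')⟩)
  · simpa [hg, hsg, mul_smul] using hδ

/-- Pigeonhole on the itineraries, along a finite set `B` of times, through a finite cover by balls:
if there are fewer itineraries than separated points, two separated points share one. -/
theorem exists_separated_close {t : Finset X} {δ δ₀ : ℝ} (ht : ∀ x, ∃ z ∈ t, dist x z < δ / 2)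
    {F B : Finset Γ} (h : ((t.card ^ B.card : ℕ) : ℕ∞) < sepNumber X F δ₀) :
    ∃ x y : X, (∃ g ∈ F, δ₀ ≤ dist (g • x) (g • y)) ∧ ∀ g ∈ B, dist (g • x) (g • y) < δ := by
  simp only [sepNumber, lt_iSup_iff] at h
  obtain ⟨Y, hY, hlt⟩ := h
  choose p hpt hp using ht
  have hcard : (Set.univ : Set (B → t)).encard < Y.encard := by
    simpa [Set.encard_univ] using hlt
  obtain ⟨x, hx, y, hy, hne, hxy⟩ := Set.exists_ne_map_eq_of_encard_lt_of_maps_to hcard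
    (f := fun x (g : B) => (⟨p ((g : Γ) • x), hpt _⟩ : t)) fun _ _ => Set.mem_univ _
  refine ⟨x, y, hY x hx y hy hne, fun g hg => ?_⟩
  have hpg : p (g • x) = p (g • y) := congrArg Subtype.val (congrFun hxy ⟨g, hg⟩)
  have h₁ := hp (g • x)
  have h₂ := hp (g • y)
  rw [← hpg] at h₂
  linarith [dist_triangle_right (g • x) (g • y) (p (g • x))]

/-- Positive entropy yields a scale `δ₀` and a rate `a > 0` such that there are arbitrarily
invariant sets `F` with more than `exp (a |F|)` points that are `(F, δ₀)`-separated. -/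
theorem exists_separation_rate (hent : 0 < topEntropy Γ X) :
    ∃ δ₀ : ℝ, 0 < δ₀ ∧ ∃ a : ℝ, 0 < a ∧ ∀ (K : Finset Γ) (η : ℝ), 0 < η →
      ∃ F ∈ leftInvariantSets Γ K η, ∀ n : ℕ, (n : ℝ) ≤ Real.exp (a * F.card) →
        (n : ℕ∞) < sepNumber X F δ₀ := by
  simp only [topEntropy, lt_iSup_iff] at hent
  obtain ⟨δ₀, hδ₀, hlim⟩ := hent
  obtain ⟨a, ha, hlim⟩ := EReal.lt_iff_exists_real_btwn.1 hlim
  refine ⟨δ₀, hδ₀, a, EReal.coe_pos.1 ha, fun K η hη => ?_⟩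
  have hev : ∀ᶠ F in folnerFilter Γ, F ∈ leftInvariantSets Γ K η :=
    Filter.mem_iInf_of_mem K (Filter.mem_iInf_of_mem η
      (Filter.mem_iInf_of_mem hη (Filter.mem_principal_self _)))
  obtain ⟨F, hlt, hF⟩ :=
    ((Filter.frequently_lt_of_lt_limsup (by isBoundedDefault) hlim).and_eventually hev).exists
  refine ⟨F, hF, fun n hn => ?_⟩
  have hpos : (0 : EReal) < (F.card : EReal) := by exact_mod_cast hF.1.card_pos
  rw [EReal.lt_div_iff hpos (EReal.natCast_ne_top _)] at hlt
  by_contra! hsep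
  have hsep' : ((sepNumber X F δ₀ : ℕ∞) : ℝ≥0∞) ≤ (n : ℝ≥0∞) := by
    exact_mod_cast ENat.toENNReal_le.2 hsep
  have hlog : ENNReal.log ((sepNumber X F δ₀ : ℕ∞) : ℝ≥0∞) ≤ ((a * F.card : ℝ) : EReal) := by
    have hexp : (n : ℝ≥0∞) ≤ ENNReal.ofReal (Real.exp (a * F.card)) := by
      rw [← ENNReal.ofReal_natCast]
      exact ENNReal.ofReal_le_ofReal hn
    refine (ENNReal.log_monotone (hsep'.trans hexp)).trans ?_
    rw [ENNReal.log_ofReal_of_pos (Real.exp_pos _), Real.log_exp]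
  refine hlog.not_gt ?_
  simpa using hlt

open scoped Classical in
/-- The `S`-boundary of an `(S, η)`-invariant set is small: it is a union of `|S|` symmetric
differences of size at most `η |F|`. -/
theorem card_boundary_le {S F : Finset Γ} {η : ℝ} (hF : F ∈ leftInvariantSets Γ S η) :
    ((S.biUnion fun s => (s • F) ∆ F).card : ℝ) ≤ S.card * (η * F.card) := by
  have h₁ : ((S.biUnion fun s => (s • F) ∆ F).card : ℝ) ≤ ∑ s ∈ S, (((s • F) ∆ F).card : ℝ) := by
    exact_mod_cast Finset.card_biUnion_le
  refine h₁.trans ?_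
  rw [← nsmul_eq_mul]
  refine Finset.sum_le_card_nsmul _ _ _ fun s hs => ?_
  rw [← Set.ncard_coe_finset, Finset.coe_symmDiff, Finset.coe_smul_finset]
  exact hF.2 s hs

end GroupDynamics

theorem mainTheorem1 {Γ : Type*} [Group Γ] [Countable Γ] (hΓ : GroupDynamics.IsAmenable Γ)
    {X : Type*} [MetricSpace X] [CompactSpace X] [MulAction Γ X] [ContinuousConstSMul Γ X]
    (hexp : GroupDynamics.IsExpansive Γ X)
    (hpot : GroupDynamics.HasPseudoOrbitTracing Γ X)
    (hent : 0 < GroupDynamics.topEntropy Γ X) :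
    ∃ x y : X, x ≠ y ∧ GroupDynamics.IsAsymptoticPair Γ x y := by
  classical
  obtain ⟨c, hc, hexp⟩ := hexp
  obtain ⟨δ₀, hδ₀, a, ha, hrate⟩ := GroupDynamics.exists_separation_rate hent
  obtain ⟨δ, hδ, S, htrace⟩ := hpot (min c δ₀) (lt_min hc hδ₀)
  obtain ⟨t, ht⟩ : ∃ t : Finset X, ∀ x, ∃ z ∈ t, dist x z < δ / 2 := by
    obtain ⟨t, htf, hcov⟩ := Metric.totallyBounded_iff.1
      (isCompact_univ (X := X)).totallyBounded (δ / 2) (half_pos hδ)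
    refine ⟨htf.toFinset, fun x => ?_⟩
    simpa using hcov (Set.mem_univ x)
  -- The bound `exp (|B| |t|)` on the number of itineraries is below `exp (a |F|)` for this `η`.
  set M : ℝ := S.card * t.card + 1 with hM
  have hMpos : 0 < M := by positivity
  obtain ⟨F, hF, hsep⟩ := hrate S (a / M) (div_pos ha hMpos)
  set B : Finset Γ := S.biUnion fun s => (s • F) ∆ F with hB
  have hBcard : (B.card : ℝ) ≤ S.card * (a / M * F.card) := GroupDynamics.card_boundary_le hF
  have hcount : ((t.card ^ B.card : ℕ) : ℝ) ≤ Real.exp (a * F.card) := by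
    have hle : (t.card : ℝ) ≤ Real.exp t.card := by linarith [Real.add_one_le_exp (t.card : ℝ)]
    calc ((t.card ^ B.card : ℕ) : ℝ) = (t.card : ℝ) ^ B.card := by push_cast; rfl
      _ ≤ Real.exp t.card ^ B.card := pow_le_pow_left₀ (Nat.cast_nonneg _) hle _
      _ = Real.exp (B.card * t.card) := (Real.exp_nat_mul _ _).symm
      _ ≤ Real.exp (a * F.card) := Real.exp_le_exp.2 ?_
    calc (B.card : ℝ) * t.card ≤ S.card * (a / M * F.card) * t.card := by gcongr
      _ = a * F.card * ((S.card * t.card) / M) := by ring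
      _ ≤ a * F.card * 1 := by
        gcongr
        rw [div_le_one hMpos, hM]
        linarith
      _ = a * F.card := mul_one _
  obtain ⟨x, y, ⟨g₀, hg₀, hfar⟩, hclose⟩ :=
    GroupDynamics.exists_separated_close ht (hsep _ hcount)
  obtain ⟨z, hz⟩ := htrace _ (GroupDynamics.isPseudoOrbit_piecewise (S := S) (F := (F : Set Γ)) hδ
    fun s hs g hg => hclose g (Finset.mem_biUnion.2 ⟨s, hs, by
      rwa [← Finset.mem_coe, Finset.coe_symmDiff, Finset.coe_smul_finset]⟩))
  refine ⟨z, y, ?_, GroupDynamics.isAsymptoticPair_of_dist_le_off_finite hexp F.finite_toSet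
    fun g hg => ?_⟩
  · rintro rfl
    have h := hz g₀
    rw [Set.piecewise_eq_of_mem _ _ _ (Finset.mem_coe.2 hg₀), dist_comm] at h
    exact hfar.not_gt (h.trans_le (min_le_right _ _))
  · have h := hz g
    rw [Set.piecewise_eq_of_notMem _ _ _ hg] at h
    exact (h.trans_le (min_le_left _ _)).le
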